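/- Let $1\le k\le d$ and $\mu\ge 0$. For $S,S'\subseteq\{1,\dots,d\}$ with $|S|=|S'|=k$ put $v_{S,S'}=\mathbf 1_S\mathbf 1_{S'}^T\in\{0,1\}^{d\times d}$. In the isotropic setting one observes a $d\times d$ matrix $y\sim\mathbb P_{S,S'}=\mathcal N(\mu v_{S,S'},I_{d^2})$ and the minimax risk is $$\mathcal R_{d,k}(\mu)=\inf_T\max_{S,S'}\mathbb P_{S,S'}[T(y)\neq(S,S')],$$ the infimum being over all measurable maps $T$ from $\mathbb R^{d\times d}$ to the set of pairs $(S,S')$. With budget $\tau>0$, one chooses $B\in\mathbb R_{\ge 0}^{d\times d}$ with $\sum_{a,b}B(a,b)\le\tau$ and observes, under $\mathbb P_{S,S',B}$, independent entries $y(a,b)\sim\mathcal N(\mu v_{S,S'}(a,b),B(a,b)^{-1})$, where $y(a,b)=0$ almost surely if $B(a,b)=0$; the minimax risk is $$\mathcal R_{d,k}(\mu,\tau)=\inf_{B,T}\max_{S,S'}\mathbb P_{S,S',B}[T(y)\neq(S,S')].$$ 1. (Minimax rates.) Let $(d_n)$, $(k_n)$ be integer sequences with $1\le k_n<d_n$ and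 $d_n\to\infty$, and let $\tau_n>0$ and $\mu_n\ge 0$ be real sequences. (a) The minimax rate is $\mu\asymp\sqrt{\log(k(d-k))/k}$: with $f_n=\sqrt{\log(k_n(d_n-k_n))/k_n}$, if $\mu_n=\omega(f_n)$ then $\mathcal R_{d_n,k_n}(\mu_n)\to 0$, and if $\mu_n=o(f_n)$ then $\mathcal R_{d_n,k_n}(\mu_n)\to 1$. (b) Under budget $\tau$ it is $\mu\asymp\sqrt{\frac{d^2}{\tau k}\log(k(d-k))}$: with $g_n=\sqrt{\frac{d_n^2}{\tau_nk_n}\log(k_n(d_n-k_n))}$, if $\mu_n=\omega(g_n)$ then $\mathcal R_{d_n,k_n}(\mu_n,\tau_n)\to 0$, and if $\mu_n=o(g_n)$ then $\mathcal R_{d_n,k_n}(\mu_n,\tau_n)\to 1$. 2. (Optimality of the MLE.) Let $k\le d$ and $\mu>0$ be fixed. The family $\{\mu v_{S,S'}\}$ is invariant under row and column permutations: applying all pairs of a row and a column permutation to any one member yields exactly the family. In the isotropic setting a maximum likelihood estimator exists, that is, a measurable $T$ such that $T(y)$ maximizes the density of $\mathbb P_{S,S'}$ at $y$ over $(S,S')$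 for every $y$, and every such $T$ is minimax optimal: $\max_{S,S'}\mathbb P_{S,S'}[T(y)\neq(S,S')]=\mathcal R_{d,k}(\mu)$. -/

import Mathlib

open MeasureTheory ProbabilityTheory Filter Asymptotics
open scoped ENNReal NNReal Topology

noncomputable section

namespace NormalMeans

/-- Maximum risk `sup_j P_j[T(y) ≠ j]` of an estimator `T` of the index `j`. -/
def maxRisk {Ω J : Type*} [MeasurableSpace Ω] (P : J → Measure Ω) (T : Ω → J) : ℝ≥0∞ :=
  ⨆ j, P j {y | T y ≠ j}

/-- Minimax risk `inf_T sup_j P_j[T(y) ≠ j]`, the infimum being over the measurable maps into the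
(discrete) set of indices. -/
def minimaxRisk {Ω J : Type*} [MeasurableSpace Ω] (P : J → Measure Ω) : ℝ≥0∞ :=
  ⨅ (T : Ω → J) (_ : Measurable[_, ⊤] T), maxRisk P T

/-- `P_j = N(v_j, I)` on `ℝ^ι`. -/
def isotropicLaw {ι J : Type*} [Fintype ι] (v : J → ι → ℝ) (j : J) : Measure (ι → ℝ) :=
  Measure.pi fun i => gaussianReal (v j i) 1

/-- `P_{j,B}`: independent coordinates `y(i) ~ N(v_j(i), B(i)⁻¹)`, and `y(i) = 0` almost surely
where `B(i) = 0`. -/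
def designLaw {ι J : Type*} [Fintype ι] (v : J → ι → ℝ) (B : ι → ℝ≥0) (j : J) :
    Measure (ι → ℝ) :=
  Measure.pi fun i => if B i = 0 then Measure.dirac 0 else gaussianReal (v j i) (B i)⁻¹

/-- Minimax risk under a budget: the infimum over the sensing strategies `B ≥ 0` with
`‖B‖₁ ≤ τ` and over the estimators. -/
def designMinimaxRisk {ι J : Type*} [Fintype ι] (v : J → ι → ℝ) (τ : ℝ) : ℝ≥0∞ :=
  ⨅ (B : ι → ℝ≥0) (_ : ∑ i, (B i : ℝ) ≤ τ), minimaxRisk (designLaw v B)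

/-- The density of `N(v_j, I)` at `y`. -/
def likelihood {ι J : Type*} [Fintype ι] (v : J → ι → ℝ) (j : J) (y : ι → ℝ) : ℝ :=
  ∏ i, gaussianPDFReal (v j i) 1 (y i)

/-- `T` is a maximum likelihood estimator in the isotropic setting (ties broken in any
measurable way). -/
def IsMLE {ι J : Type*} [Fintype ι] (v : J → ι → ℝ) (T : (ι → ℝ) → J) : Prop :=
  Measurable[_, ⊤] T ∧ ∀ y j, likelihood v j y ≤ likelihood v (T y) y

/-- The minimax rate `μ ≍ f(n)`, where `R n μ` is the minimax risk of the `n`-th problem at signal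
strength `μ`: the risk tends to `0` if `μ = ω(f)`, and to `1` if `μ = o(f)`. -/
def IsMinimaxRate (R : ℕ → ℝ → ℝ≥0∞) (f : ℕ → ℝ) : Prop :=
  ∀ μ : ℕ → ℝ, (∀ n, 0 ≤ μ n) →
    (f =o[atTop] μ → Tendsto (fun n => R n (μ n)) atTop (𝓝 0)) ∧
    (μ =o[atTop] f → Tendsto (fun n => R n (μ n)) atTop (𝓝 1))

/-- The subsets of `{1, …, d}` of size `k`. -/
abbrev KSet (d k : ℕ) : Type := {S : Finset (Fin d) // S.card = k}

/-- The `k × k` biclusters in `d × d` matrices at signal strength `μ`: the matrices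
`μ 1_S 1_{S'}ᵀ` with `|S| = |S'| = k`. -/
def bicluster (d k : ℕ) (μ : ℝ) (j : KSet d k × KSet d k) : Fin d × Fin d → ℝ :=
  fun p => if p.1 ∈ j.1.1 ∧ p.2 ∈ j.2.1 then μ else 0

end NormalMeans

end

/-! ### Product measures, Gaussian densities and measurable selection -/

namespace NormalMeans

/-! Write A = k(d-k) and s = τk/d². The isotropic problem is the uniform design of precision 1 with
τ = d², so both rates follow from two non-asymptotic bounds in μ²s, turned into limits by
`isMinimaxRate_of_bounds`.

Upper bound: spread the budget uniformly and pick the bicluster with the largest sum. A Chernoff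
bound shows that a rival differing in m rows and columns altogether wins with probability at most
q^m, where q = exp(-μ²s/8). The union bound splits into a row sum and a column sum, each at most
exp(Aq) (`sum_kset_pow_card_sdiff_le`), so the risk is at most exp(2Aq) - 1.

Lower bound: whatever the design, averaging finds k columns carrying at most their share kτ/d of the
budget, and at least three quarters of the rows carry at most four times the average within them.
Toggling one light row in a set of k-1 or k+1 rows gives at least d/4 hypotheses, each differing
from a common reference mean in that row only. Their second moments relative to the reference are at
most C = exp(4μ²s), so the risk is at least 1 - 2(1+C)/√d. The bounds match because log A has order
log d.

Optimality of the MLE: maximizing the likelihood pointwise minimizes the average error. Permutations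
of rows and columns act transitively and ties are null, so the error of the MLE is the same at every
index. Its maximum therefore equals its average, which is at most the average, hence the maximum,
for any other estimator. -/

theorem lintegral_pi_prod {ι : Type*} [Fintype ι] {Ω : ι → Type*}
    [∀ i, MeasurableSpace (Ω i)] (ν : ∀ i, Measure (Ω i)) [∀ i, IsProbabilityMeasure (ν i)]
    (f : ∀ i, Ω i → ℝ≥0∞) (hf : ∀ i, Measurable (f i)) :
    ∫⁻ y, ∏ i, f i (y i) ∂Measure.pi ν = ∏ i, ∫⁻ x, f i x ∂ν i := by
  refine (lintegral_prod_eq_prod_lintegral_of_indepFun Finset.univ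
    (fun i (y : ∀ i, Ω i) => f i (y i))
    (iIndepFun_pi fun i => (hf i).aemeasurable) (fun i => by fun_prop)).trans ?_
  refine Finset.prod_congr rfl fun i _ => ?_
  exact (measurePreserving_eval ν i).lintegral_comp (hf i)

theorem pi_withDensity {ι : Type*} [Fintype ι] {Ω : ι → Type*}
    [∀ i, MeasurableSpace (Ω i)] (ν ρ : ∀ i, Measure (Ω i)) [∀ i, IsProbabilityMeasure (ν i)]
    [∀ i, IsProbabilityMeasure (ρ i)] (f : ∀ i, Ω i → ℝ≥0∞) (hf : ∀ i, Measurable (f i))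
    (h : ∀ i, ρ i = (ν i).withDensity (f i)) :
    Measure.pi ρ = (Measure.pi ν).withDensity (fun y => ∏ i, f i (y i)) := by
  refine (Measure.pi_eq fun s hs => ?_)
  rw [withDensity_apply _ (MeasurableSet.univ_pi hs),
    ← lintegral_indicator (MeasurableSet.univ_pi hs)]
  have hind : ∀ y : ∀ i, Ω i, (Set.univ.pi s).indicator (fun y => ∏ i, f i (y i)) y =
      ∏ i, (s i).indicator (f i) (y i) := by
    intro y
    by_cases hy : y ∈ Set.univ.pi s
    · rw [Set.indicator_of_mem hy]
      exact Finset.prod_congr rfl fun i _ => (Set.indicator_of_mem (hy i trivial) _).symm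
    · rw [Set.indicator_of_notMem hy]
      simp only [Set.mem_pi, Set.mem_univ, true_imp_iff, not_forall] at hy
      obtain ⟨i, hi⟩ := hy
      exact (Finset.prod_eq_zero (Finset.mem_univ i) (Set.indicator_of_notMem hi _)).symm
  simp_rw [hind]
  rw [lintegral_pi_prod ν _ fun i => (hf i).indicator (hs i)]
  refine Finset.prod_congr rfl fun i _ => ?_
  rw [h i, withDensity_apply _ (hs i), lintegral_indicator (hs i)]

theorem lintegral_exp_gaussianReal (m : ℝ) (v : ℝ≥0) (t c : ℝ) :
    ∫⁻ x, ENNReal.ofReal (Real.exp (t * x + c)) ∂gaussianReal m v =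
      ENNReal.ofReal (Real.exp (m * t + v * t ^ 2 / 2 + c)) := by
  have h : ∫ x, Real.exp (t * x) ∂gaussianReal m v = Real.exp (m * t + v * t ^ 2 / 2) :=
    congrFun (mgf_id_gaussianReal (μ := m) (v := v)) t
  simp_rw [Real.exp_add _ c]
  rw [← h, ← integral_mul_const, ofReal_integral_eq_lintegral_ofReal]
  · exact (integrable_exp_mul_gaussianReal t).mul_const _
  · exact ae_of_all _ fun x => by positivity

/-- The density of `N(m, v)` with respect to `N(w, v)`. -/
noncomputable def gaussianRatio (w m : ℝ) (v : ℝ≥0) (x : ℝ) : ℝ :=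
  Real.exp ((m - w) / v * x + (w ^ 2 - m ^ 2) / (2 * v))

theorem gaussianRatio_pos (w m : ℝ) (v : ℝ≥0) (x : ℝ) : 0 < gaussianRatio w m v x :=
  Real.exp_pos _

theorem measurable_gaussianRatio (w m : ℝ) (v : ℝ≥0) : Measurable (gaussianRatio w m v) := by
  unfold gaussianRatio; fun_prop

theorem gaussianPDFReal_eq_mul_ratio (w m : ℝ) {v : ℝ≥0} (hv : v ≠ 0) (x : ℝ) :
    gaussianPDFReal m v x = gaussianPDFReal w v x * gaussianRatio w m v x := by
  have hv' : (v : ℝ) ≠ 0 := by exact_mod_cast hv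
  rw [gaussianPDFReal, gaussianPDFReal, gaussianRatio, mul_assoc (√_)⁻¹, ← Real.exp_add]
  congr 2
  field_simp
  ring

theorem gaussianReal_eq_withDensity_ratio (w m : ℝ) {v : ℝ≥0} (hv : v ≠ 0) :
    gaussianReal m v =
      (gaussianReal w v).withDensity (fun x => ENNReal.ofReal (gaussianRatio w m v x)) := by
  rw [gaussianReal_of_var_ne_zero m hv, gaussianReal_of_var_ne_zero w hv,
    ← withDensity_mul _ (measurable_gaussianPDF w v)
      (measurable_gaussianRatio w m v).ennreal_ofReal]
  congr 1
  ext x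
  rw [Pi.mul_apply, gaussianPDF, gaussianPDF, gaussianPDFReal_eq_mul_ratio w m hv x,
    ENNReal.ofReal_mul (gaussianPDFReal_nonneg _ _ _)]

/-- The square of the ratio is still the exponential of an affine function, so the Gaussian moment
generating function evaluates it. The value is one plus the χ²-divergence. -/
theorem lintegral_sq_gaussianRatio (w m : ℝ) {v : ℝ≥0} (hv : v ≠ 0) :
    ∫⁻ x, ENNReal.ofReal (gaussianRatio w m v x) ^ 2 ∂gaussianReal w v =
      ENNReal.ofReal (Real.exp ((m - w) ^ 2 / v)) := by
  have hv' : (v : ℝ) ≠ 0 := by exact_mod_cast hv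
  have h : ∀ x, ENNReal.ofReal (gaussianRatio w m v x) ^ 2 = ENNReal.ofReal
      (Real.exp ((2 * (m - w) / v) * x + (w ^ 2 - m ^ 2) / v)) := by
    intro x
    rw [← ENNReal.ofReal_pow (gaussianRatio_pos _ _ _ _).le, gaussianRatio, ← Real.exp_nat_mul]
    congr 2
    push_cast
    field_simp
  simp_rw [h]
  rw [lintegral_exp_gaussianReal]
  congr 2
  field_simp
  ring

/-- The linear form is Gaussian with variance ∑ a i ^ 2 > 0, hence has no atoms. -/
theorem pi_gaussianReal_hyperplane {ι : Type*} [Fintype ι] (m a : ι → ℝ) (ha : a ≠ 0) (c : ℝ) :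
    Measure.pi (fun i => gaussianReal (m i) 1) {y | ∑ i, a i * y i = c} = 0 := by
  set P := Measure.pi fun i => gaussianReal (m i) 1
  have hvec : HasGaussianLaw (fun y : ι → ℝ => (fun i => y i)) P := by
    refine iIndepFun.hasGaussianLaw (fun i => ⟨?_⟩) (iIndepFun_pi (X := fun _ => id)
      fun i => aemeasurable_id)
    rw [(measurePreserving_eval (fun i => gaussianReal (m i) 1) i).map_eq]
    infer_instance
  have hlaw : HasGaussianLaw (∑ i, fun y : ι → ℝ => a i * y i) P := by
    let L : (ι → ℝ) →L[ℝ] ℝ :=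
      ∑ i, a i • ContinuousLinearMap.proj (R := ℝ) (φ := fun _ : ι => ℝ) i
    have heq : (∑ i, fun y : ι → ℝ => a i * y i) = L ∘ fun y : ι → ℝ => (fun i => y i) := by
      ext y
      simp [L]
    rw [heq]
    exact hvec.map L
  have hvar : Var[∑ i, fun y : ι → ℝ => a i * y i; P] = ∑ i, a i ^ 2 := by
    rw [variance_sum_pi (X := fun i x => a i * x)
      (fun i => (memLp_id_gaussianReal 2).const_mul (a i))]
    refine Finset.sum_congr rfl fun i _ => ?_
    rw [variance_const_mul, variance_fun_id_gaussianReal]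
    simp
  have hpos : 0 < ∑ i, a i ^ 2 := by
    obtain ⟨i, hi⟩ := Function.ne_iff.1 ha
    exact Finset.sum_pos' (fun i _ => sq_nonneg _) ⟨i, Finset.mem_univ i, by
      have : a i ≠ 0 := hi
      positivity⟩
  have hmap := hlaw.map_eq_gaussianReal
  rw [hvar] at hmap
  have := nullSingletonClass_gaussianReal
    (μ := P[∑ i, fun y : ι → ℝ => a i * y i]) (Real.toNNReal_pos.2 hpos).ne'
  rw [← hmap] at this
  have h0 : P.map (∑ i, fun y : ι → ℝ => a i * y i) {c} = 0 := measure_singleton c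
  rw [Measure.map_apply (by fun_prop) (measurableSet_singleton c)] at h0
  convert h0 using 2
  ext y
  simp

/-- A finite family of measurable scores has a measurable maximizer. -/
theorem exists_measurable_argmax {Ω J : Type*} [MeasurableSpace Ω] [Fintype J] [Nonempty J]
    (f : J → Ω → ℝ) (hf : ∀ j, Measurable (f j)) :
    ∃ T : Ω → J, Measurable[_, ⊤] T ∧ ∀ y j, f j y ≤ f (T y) y := by
  classical
  let _ : MeasurableSpace J := ⊤
  have key : ∀ s : Finset J, ∃ T : Ω → J, Measurable T ∧ ∀ y, ∀ j ∈ s, f j y ≤ f (T y) y := by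
    intro s
    induction s using Finset.induction_on with
    | empty => exact ⟨fun _ => Classical.arbitrary J, measurable_const, by simp⟩
    | insert a s _ ih =>
      obtain ⟨T, hT, hmax⟩ := ih
      -- Joint measurability in (y, j) is automatic because the index set is countable and discrete.
      have hfT : Measurable fun y => f (T y) y :=
        (measurable_from_prod_countable_left (f := fun p : Ω × J => f p.2 p.1) hf).comp
          (measurable_id.prodMk hT)
      refine ⟨fun y => if f a y ≤ f (T y) y then T y else a,
        Measurable.ite (measurableSet_le (hf a) hfT) hT measurable_const, fun y j hj => ?_⟩
      dsimp only
      rcases Finset.mem_insert.1 hj with rfl | hj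
      · split_ifs with h
        exacts [h, le_rfl]
      · split_ifs with h
        exacts [hmax y j hj, (hmax y j hj).trans (not_le.1 h).le]
  obtain ⟨T, hT, hmax⟩ := key Finset.univ
  exact ⟨T, hT, fun y j => hmax y j (Finset.mem_univ j)⟩

/-! ### Maximum likelihood under a transitive symmetry -/

section MLE

variable {ι J : Type*} [Fintype ι]

instance (v : J → ι → ℝ) (j : J) : IsProbabilityMeasure (isotropicLaw v j) := by
  unfold isotropicLaw; infer_instance

theorem measurable_likelihood (v : J → ι → ℝ) (j : J) : Measurable (likelihood v j) := by
  unfold likelihood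
  exact Finset.measurable_prod _ fun i _ =>
    (measurable_gaussianPDFReal _ _).comp (measurable_pi_apply i)

/-- The density of `N(v_j, I)` with respect to `N(0, I)`. -/
noncomputable def likelihoodRatio (v : J → ι → ℝ) (j : J) (y : ι → ℝ) : ℝ :=
  ∏ i, gaussianRatio 0 (v j i) 1 (y i)

theorem measurable_likelihoodRatio (v : J → ι → ℝ) (j : J) : Measurable (likelihoodRatio v j) := by
  unfold likelihoodRatio
  exact Finset.measurable_prod _ fun i _ =>
    (measurable_gaussianRatio _ _ _).comp (measurable_pi_apply i)

theorem likelihoodRatio_eq_exp (v : J → ι → ℝ) (j : J) (y : ι → ℝ) :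
    likelihoodRatio v j y = Real.exp (∑ i, (v j i * y i - v j i ^ 2 / 2)) := by
  rw [likelihoodRatio, Real.exp_sum]
  refine Finset.prod_congr rfl fun i _ => ?_
  rw [gaussianRatio]
  congr 1
  simp
  ring

theorem likelihood_eq_mul_ratio (v : J → ι → ℝ) (j : J) (y : ι → ℝ) :
    likelihood v j y = (∏ i, gaussianPDFReal 0 1 (y i)) * likelihoodRatio v j y := by
  rw [likelihood, likelihoodRatio, ← Finset.prod_mul_distrib]
  exact Finset.prod_congr rfl fun i _ => gaussianPDFReal_eq_mul_ratio _ _ one_ne_zero _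

theorem likelihood_le_iff (v : J → ι → ℝ) (j j' : J) (y : ι → ℝ) :
    likelihood v j y ≤ likelihood v j' y ↔ likelihoodRatio v j y ≤ likelihoodRatio v j' y := by
  rw [likelihood_eq_mul_ratio, likelihood_eq_mul_ratio]
  exact mul_le_mul_iff_right₀ (Finset.prod_pos fun i _ => gaussianPDFReal_pos _ _ _ one_ne_zero)

theorem isotropicLaw_eq_withDensity (v : J → ι → ℝ) (j : J) :
    isotropicLaw v j = (Measure.pi fun _ : ι => gaussianReal 0 1).withDensity
      (fun y => ENNReal.ofReal (likelihoodRatio v j y)) := by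
  rw [isotropicLaw, pi_withDensity (fun _ => gaussianReal 0 1) (fun i => gaussianReal (v j i) 1)
    (fun i x => ENNReal.ofReal (gaussianRatio 0 (v j i) 1 x))
    (fun i => (measurable_gaussianRatio _ _ _).ennreal_ofReal)
    (fun i => gaussianReal_eq_withDensity_ratio 0 (v j i) one_ne_zero)]
  congr 1
  ext y
  rw [likelihoodRatio, ENNReal.ofReal_prod_of_nonneg fun i _ => (gaussianRatio_pos _ _ _ _).le]

theorem measurableSet_eq_of_measurable_top {Ω : Type*} [MeasurableSpace Ω] {T : Ω → J}
    (hT : Measurable[_, ⊤] T) (j : J) : MeasurableSet {y | T y = j} :=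
  hT (t := {j}) trivial

/-- With all laws written against N(0, I), exactly one term of the sum, the index T y, survives at
each y. -/
theorem sum_success_eq_lintegral [Fintype J] (v : J → ι → ℝ) {T : (ι → ℝ) → J}
    (hT : Measurable[_, ⊤] T) :
    ∑ j, isotropicLaw v j {y | T y = j} =
      ∫⁻ y, ENNReal.ofReal (likelihoodRatio v (T y) y) ∂Measure.pi fun _ : ι => gaussianReal 0 1 := by
  classical
  have h : ∀ j, isotropicLaw v j {y | T y = j} =
      ∫⁻ y, {y | T y = j}.indicator (fun y => ENNReal.ofReal (likelihoodRatio v j y)) y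
        ∂Measure.pi fun _ : ι => gaussianReal 0 1 := fun j => by
    rw [isotropicLaw_eq_withDensity, withDensity_apply _ (measurableSet_eq_of_measurable_top hT j),
      lintegral_indicator (measurableSet_eq_of_measurable_top hT j)]
  simp_rw [h]
  rw [← lintegral_finsetSum _ fun j _ => (measurable_likelihoodRatio v j).ennreal_ofReal.indicator
    (measurableSet_eq_of_measurable_top hT j)]
  refine lintegral_congr fun y => ?_
  rw [Finset.sum_eq_single (T y)]
  · exact Set.indicator_of_mem (by simp) _
  · exact fun j _ hj => Set.indicator_of_notMem (by simpa using hj.symm) _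
  · simp

/-- The MLE maximizes the integrand of `sum_success_eq_lintegral` pointwise: it is the Bayes
estimator for the uniform prior. -/
theorem sum_error_le_of_isMLE [Fintype J] {v : J → ι → ℝ} {T : (ι → ℝ) → J} (hT : IsMLE v T)
    {T' : (ι → ℝ) → J} (hT' : Measurable[_, ⊤] T') :
    ∑ j, isotropicLaw v j {y | T y ≠ j} ≤ ∑ j, isotropicLaw v j {y | T' y ≠ j} := by
  have hsplit : ∀ {U : (ι → ℝ) → J}, Measurable[_, ⊤] U →
      ∑ j, isotropicLaw v j {y | U y = j} + ∑ j, isotropicLaw v j {y | U y ≠ j} =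
        (Fintype.card J : ℝ≥0∞) := fun {U} hU => by
    rw [← Finset.sum_add_distrib]
    simp_rw [fun j => (show {y | U y ≠ j} = {y | U y = j}ᶜ from rfl),
      fun j => measure_add_measure_compl (μ := isotropicLaw v j)
        (measurableSet_eq_of_measurable_top hU j)]
    simp
  have hle : ∑ j, isotropicLaw v j {y | T' y = j} ≤ ∑ j, isotropicLaw v j {y | T y = j} := by
    rw [sum_success_eq_lintegral v hT', sum_success_eq_lintegral v hT.1]
    exact lintegral_mono fun y => ENNReal.ofReal_le_ofReal ((likelihood_le_iff v _ _ y).1 (hT.2 y _))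
  have hfin : ∑ j, isotropicLaw v j {y | T y = j} ≠ ∞ :=
    ENNReal.sum_ne_top.2 fun j _ => measure_ne_top _ _
  refine (ENNReal.add_le_add_iff_left hfin).1 ?_
  rw [hsplit hT.1, ← hsplit hT']
  gcongr

/-- The event that some other index is at least as likely as `j`. -/
def rivalEvent (v : J → ι → ℝ) (j : J) : Set (ι → ℝ) :=
  {y | ∃ j', j' ≠ j ∧ likelihood v j y ≤ likelihood v j' y}

theorem measurableSet_rivalEvent [Countable J] (v : J → ι → ℝ) (j : J) :
    MeasurableSet (rivalEvent v j) := by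
  have h : rivalEvent v j = ⋃ j', ⋃ _ : j' ≠ j, {y | likelihood v j y ≤ likelihood v j' y} := by
    ext y; simp [rivalEvent]
  rw [h]
  exact .iUnion fun j' => .iUnion fun _ =>
    measurableSet_le (measurable_likelihood v j) (measurable_likelihood v j')

/-- The log-likelihood ratio is affine in y with linear part v j₁ - v j₂ ≠ 0, so ties lie in a
hyperplane. -/
theorem isotropicLaw_tie_eq_zero {v : J → ι → ℝ} {j₁ j₂ : J} (h : v j₁ ≠ v j₂) (j : J) :
    isotropicLaw v j {y | likelihood v j₁ y = likelihood v j₂ y} = 0 := by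
  refine measure_mono_null (fun y hy => ?_) (pi_gaussianReal_hyperplane (v j)
    (v j₁ - v j₂) (sub_ne_zero.2 h) (∑ i, (v j₁ i ^ 2 / 2 - v j₂ i ^ 2 / 2)))
  have hy' : likelihoodRatio v j₁ y = likelihoodRatio v j₂ y :=
    le_antisymm ((likelihood_le_iff v _ _ y).1 (le_of_eq hy))
      ((likelihood_le_iff v _ _ y).1 (ge_of_eq hy))
  rw [likelihoodRatio_eq_exp, likelihoodRatio_eq_exp, Real.exp_eq_exp] at hy'
  simp only [Finset.sum_sub_distrib] at hy'
  simp only [Set.mem_ofPred_eq, Pi.sub_apply, sub_mul, Finset.sum_sub_distrib]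
  linarith

/-- Arbitrary tie-breaking may destroy the equivariance of T. The rival event depends on the
likelihoods alone, so it is equivariant, and it differs from the error event only by ties. -/
theorem isotropicLaw_error_eq_rivalEvent [Countable J] {v : J → ι → ℝ} (hv : v.Injective)
    {T : (ι → ℝ) → J} (hT : IsMLE v T) (j : J) :
    isotropicLaw v j {y | T y ≠ j} = isotropicLaw v j (rivalEvent v j) := by
  refine le_antisymm (measure_mono fun y hy => ⟨T y, hy, hT.2 y j⟩) ?_
  have hsub : rivalEvent v j ⊆ {y | T y ≠ j} ∪
      ⋃ j', ⋃ _ : j' ≠ j, {y | likelihood v j y = likelihood v j' y} := by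
    rintro y ⟨j', hne, hle⟩
    by_cases hy : T y = j
    · refine Or.inr (Set.mem_iUnion₂.2 ⟨j', hne, le_antisymm hle ?_⟩)
      simpa [hy] using hT.2 y j'
    · exact Or.inl hy
  have hnull : isotropicLaw v j
      (⋃ j', ⋃ _ : j' ≠ j, {y | likelihood v j y = likelihood v j' y}) = 0 :=
    measure_iUnion_null fun j' => measure_iUnion_null fun hne =>
      isotropicLaw_tie_eq_zero (hv.ne hne.symm) j
  calc _ ≤ _ := measure_mono hsub
    _ ≤ _ := measure_union_le _ _
    _ = _ := by rw [hnull, add_zero]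

theorem measurable_comp_perm {ι : Type*} (e : Equiv.Perm ι) : Measurable fun y : ι → ℝ => y ∘ e :=
  measurable_pi_lambda _ fun i => measurable_pi_apply (e i)

theorem map_comp_perm_isotropicLaw (v : J → ι → ℝ) (e : Equiv.Perm ι) {j j' : J}
    (h : v j' = v j ∘ e) :
    (isotropicLaw v j).map (fun y => y ∘ e) = isotropicLaw v j' := by
  symm
  refine Measure.pi_eq fun s hs => ?_
  rw [Measure.map_apply (measurable_comp_perm e) (MeasurableSet.univ_pi hs)]
  have hpre : (fun y : ι → ℝ => y ∘ e) ⁻¹' Set.univ.pi s = Set.univ.pi fun i => s (e.symm i) := by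
    ext y
    simp only [Set.mem_preimage, Set.mem_pi, Set.mem_univ, true_imp_iff, Function.comp_apply]
    exact ⟨fun hy i => by simpa using hy (e.symm i), fun hy i => by simpa using hy (e i)⟩
  rw [hpre, isotropicLaw, Measure.pi_pi, ← Equiv.prod_comp e]
  simp [h]

theorem likelihood_comp_perm (v : J → ι → ℝ) (e : Equiv.Perm ι) {j j' : J}
    (h : v j' = v j ∘ e) (y : ι → ℝ) : likelihood v j' (y ∘ e) = likelihood v j y := by
  simp only [likelihood, h, Function.comp_apply]
  exact Equiv.prod_comp e fun i => gaussianPDFReal (v j i) 1 (y i)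

theorem isotropicLaw_rivalEvent_perm [Countable J] (v : J → ι → ℝ) (e : Equiv.Perm ι)
    (σ : Equiv.Perm J) (h : ∀ j, v (σ j) = v j ∘ e) (j : J) :
    isotropicLaw v (σ j) (rivalEvent v (σ j)) = isotropicLaw v j (rivalEvent v j) := by
  rw [← map_comp_perm_isotropicLaw v e (h j),
    Measure.map_apply (measurable_comp_perm e) (measurableSet_rivalEvent v _)]
  congr 1
  ext y
  simp only [rivalEvent, Set.mem_preimage, Set.mem_ofPred_eq, likelihood_comp_perm v e (h j)]
  constructor
  · rintro ⟨j', hne, hle⟩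
    obtain ⟨j', rfl⟩ := σ.surjective j'
    exact ⟨j', fun h' => hne (congrArg σ h'), by rwa [likelihood_comp_perm v e (h j')] at hle⟩
  · rintro ⟨i, hne, hle⟩
    exact ⟨σ i, σ.injective.ne hne, by rwa [likelihood_comp_perm v e (h i)]⟩

/-- If a group of coordinate permutations acts transitively on the means, then every maximum
likelihood estimator is minimax. -/
theorem maxRisk_eq_minimaxRisk_of_isMLE [Fintype J] [Nonempty J] {v : J → ι → ℝ}
    (hv : v.Injective)
    (hsymm : ∀ j₁ j₂, ∃ (e : Equiv.Perm ι) (σ : Equiv.Perm J),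
      (∀ j, v (σ j) = v j ∘ e) ∧ σ j₁ = j₂)
    {T : (ι → ℝ) → J} (hT : IsMLE v T) :
    maxRisk (isotropicLaw v) T = minimaxRisk (isotropicLaw v) := by
  obtain ⟨j₀⟩ := ‹Nonempty J›
  have hconst : ∀ j, isotropicLaw v j {y | T y ≠ j} = isotropicLaw v j₀ {y | T y ≠ j₀} := by
    intro j
    obtain ⟨e, σ, hσ, rfl⟩ := hsymm j₀ j
    rw [isotropicLaw_error_eq_rivalEvent hv hT, isotropicLaw_error_eq_rivalEvent hv hT,
      isotropicLaw_rivalEvent_perm v e σ hσ]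
  refine le_antisymm (le_iInf₂ fun T' hT' => ?_) (iInf₂_le T hT.1)
  have hsum := sum_error_le_of_isMLE hT hT'
  simp_rw [hconst] at hsum
  have hle : ∑ j, isotropicLaw v j {y | T' y ≠ j} ≤
      ∑ _j : J, maxRisk (isotropicLaw v) T' :=
    Finset.sum_le_sum fun j _ => le_iSup (fun j => isotropicLaw v j {y | T' y ≠ j}) j
  have hmul := hsum.trans hle
  simp only [Finset.sum_const, nsmul_eq_mul] at hmul
  have hcard : ((Finset.univ : Finset J).card : ℝ≥0∞) ≠ 0 := by
    simp
  have hmax : maxRisk (isotropicLaw v) T ≤ isotropicLaw v j₀ {y | T y ≠ j₀} :=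
    iSup_le fun j => (hconst j).le
  exact hmax.trans ((ENNReal.mul_le_mul_iff_right hcard (ENNReal.natCast_ne_top _)).1 hmul)

theorem exists_isMLE [Fintype J] [Nonempty J] (v : J → ι → ℝ) : ∃ T, IsMLE v T :=
  exists_measurable_argmax (likelihood v) (measurable_likelihood v)

end MLE

/-! ### Row and column permutations of biclusters -/

section Symmetry

variable {d k : ℕ}

/-- The action of a permutation of `{1, …, d}` on the subsets of size `k`. -/
def ksetPerm (g : Equiv.Perm (Fin d)) : Equiv.Perm (KSet d k) :=
  (Equiv.finsetCongr g).subtypeEquiv fun S => by simp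

theorem mem_ksetPerm (g : Equiv.Perm (Fin d)) (S : KSet d k) (a : Fin d) :
    a ∈ (ksetPerm g S).1 ↔ g.symm a ∈ S.1 := by
  simp [ksetPerm, Finset.mem_map_equiv]

theorem exists_ksetPerm_eq (S S' : KSet d k) : ∃ g : Equiv.Perm (Fin d), ksetPerm g S = S' := by
  let e : {a // a ∈ S.1} ≃ {a // a ∈ S'.1} := Finset.equivOfCardEq (S.2.trans S'.2.symm)
  refine ⟨e.extendSubtype, Subtype.ext (Finset.eq_of_subset_of_card_le (fun a ha => ?_) ?_)⟩
  · rw [mem_ksetPerm] at ha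
    simpa using e.extendSubtype_mem _ ha
  · rw [S'.2, (ksetPerm _ S).2]

theorem bicluster_ksetPerm (μ : ℝ) (g g' : Equiv.Perm (Fin d)) (j : KSet d k × KSet d k) :
    bicluster d k μ (ksetPerm g j.1, ksetPerm g' j.2) =
      fun p => bicluster d k μ j (g.symm p.1, g'.symm p.2) := by
  ext p
  simp only [bicluster, mem_ksetPerm]

theorem nonempty_kset (h : k ≤ d) : Nonempty (KSet d k) := by
  obtain ⟨S, -, hS⟩ := Finset.exists_subset_card_eq (s := (Finset.univ : Finset (Fin d))) (n := k)
    (by simpa using h)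
  exact ⟨⟨S, hS⟩⟩

theorem bicluster_injective {μ : ℝ} (hμ : μ ≠ 0) : (bicluster d k μ).Injective := by
  -- For k = 0 every matrix vanishes, but there is only one index. For k > 0 a nonempty row or
  -- column section recovers each set.
  rcases Nat.eq_zero_or_pos k with rfl | hk
  · rintro ⟨S, S'⟩ ⟨T, T'⟩ -
    ext a <;> simp [Finset.card_eq_zero.1 S.2, Finset.card_eq_zero.1 S'.2,
      Finset.card_eq_zero.1 T.2, Finset.card_eq_zero.1 T'.2]
  · rintro ⟨S, S'⟩ ⟨T, T'⟩ h
    have hiff : ∀ a b, (a ∈ S.1 ∧ b ∈ S'.1) ↔ (a ∈ T.1 ∧ b ∈ T'.1) := by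
      intro a b
      have hab := congrFun h (a, b)
      simp only [bicluster] at hab
      split_ifs at hab with h₁ h₂ h₂
      exacts [iff_of_true h₁ h₂, absurd hab hμ, absurd hab.symm hμ, iff_of_false h₁ h₂]
    have hne : ∀ U : KSet d k, ∃ a, a ∈ U.1 := fun U =>
      Finset.card_pos.1 (by rw [U.2]; exact hk)
    obtain ⟨a, ha⟩ := hne S
    obtain ⟨b, hb⟩ := hne S'
    have hab := (hiff a b).1 ⟨ha, hb⟩
    refine Prod.ext (Subtype.ext (Finset.ext fun x => ?_)) (Subtype.ext (Finset.ext fun x => ?_))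
    · simpa [hb, hab.2] using hiff x b
    · simpa [ha, hab.1] using hiff a x

theorem range_bicluster_perm (μ : ℝ) (v : Fin d × Fin d → ℝ)
    (hv : v ∈ Set.range (bicluster d k μ)) :
    Set.range (fun (g : Equiv.Perm (Fin d) × Equiv.Perm (Fin d)) (p : Fin d × Fin d) =>
      v (g.1 p.1, g.2 p.2)) = Set.range (bicluster d k μ) := by
  obtain ⟨j, rfl⟩ := hv
  refine Set.Subset.antisymm ?_ ?_
  · rintro _ ⟨g, rfl⟩
    exact ⟨(ksetPerm g.1.symm j.1, ksetPerm g.2.symm j.2), bicluster_ksetPerm μ _ _ j⟩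
  · rintro _ ⟨j', rfl⟩
    obtain ⟨g, hg⟩ := exists_ksetPerm_eq j.1 j'.1
    obtain ⟨g', hg'⟩ := exists_ksetPerm_eq j.2 j'.2
    refine ⟨(g.symm, g'.symm), ?_⟩
    have h := bicluster_ksetPerm μ g g' j
    rw [hg, hg'] at h
    exact h.symm

theorem bicluster_isMLE_minimax {μ : ℝ} (h : k ≤ d) (hμ : μ ≠ 0)
    {T : (Fin d × Fin d → ℝ) → KSet d k × KSet d k} (hT : IsMLE (bicluster d k μ) T) :
    maxRisk (isotropicLaw (bicluster d k μ)) T =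
      minimaxRisk (isotropicLaw (bicluster d k μ)) := by
  have := nonempty_kset h
  refine maxRisk_eq_minimaxRisk_of_isMLE (bicluster_injective hμ) (fun j₁ j₂ => ?_) hT
  obtain ⟨g, hg⟩ := exists_ksetPerm_eq j₁.1 j₂.1
  obtain ⟨g', hg'⟩ := exists_ksetPerm_eq j₁.2 j₂.2
  exact ⟨Equiv.prodCongr g.symm g'.symm, Equiv.prodCongr (ksetPerm g) (ksetPerm g'),
    fun j => bicluster_ksetPerm μ g g' j, Prod.ext hg hg'⟩

end Symmetry

/-! ### Upper bound: Chernoff and union bounds -/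

section UpperBound

/-- Chernoff bound for a linear form of independent Gaussians. -/
theorem pi_gaussianReal_halfspace_le {ι : Type*} [Fintype ι] (m : ι → ℝ) (v : ℝ≥0) (c : ι → ℝ)
    {t : ℝ} (ht : 0 ≤ t) :
    Measure.pi (fun i => gaussianReal (m i) v) {y | 0 ≤ ∑ i, c i * y i} ≤
      ENNReal.ofReal (Real.exp (t * ∑ i, c i * m i + v * t ^ 2 / 2 * ∑ i, c i ^ 2)) := by
  -- Markov's inequality for exp(t ∑ c i y i), kept as a product so that independence applies. The
  -- `+ 0` matches the affine exponent in `lintegral_exp_gaussianReal`.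
  calc Measure.pi (fun i => gaussianReal (m i) v) {y | 0 ≤ ∑ i, c i * y i}
      ≤ Measure.pi (fun i => gaussianReal (m i) v)
        {y | 1 ≤ ∏ i, ENNReal.ofReal (Real.exp (t * c i * y i + 0))} := by
        refine measure_mono fun y hy => ?_
        have hy' : (0 : ℝ) ≤ ∑ i, c i * y i := hy
        change 1 ≤ ∏ i, ENNReal.ofReal (Real.exp (t * c i * y i + 0))
        rw [← ENNReal.ofReal_prod_of_nonneg fun i _ => (Real.exp_pos _).le, ← Real.exp_sum,
          ENNReal.one_le_ofReal, Real.one_le_exp_iff]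
        simp only [add_zero, mul_assoc, ← Finset.mul_sum]
        positivity
    _ ≤ ∫⁻ y, ∏ i, ENNReal.ofReal (Real.exp (t * c i * y i + 0))
        ∂Measure.pi (fun i => gaussianReal (m i) v) := by
        simpa using mul_meas_ge_le_lintegral (μ := Measure.pi (fun i => gaussianReal (m i) v))
          (f := fun y => ∏ i, ENNReal.ofReal (Real.exp (t * c i * y i + 0))) (by fun_prop) 1
    _ = _ := by
        rw [lintegral_pi_prod (fun i => gaussianReal (m i) v)
          (fun i x => ENNReal.ofReal (Real.exp (t * c i * x + 0))) (fun i => by fun_prop)]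
        simp_rw [lintegral_exp_gaussianReal]
        rw [← ENNReal.ofReal_prod_of_nonneg fun i _ => (Real.exp_pos _).le, ← Real.exp_sum]
        congr 2
        rw [Finset.mul_sum, Finset.mul_sum, ← Finset.sum_add_distrib]
        exact Finset.sum_congr rfl fun i _ => by ring

/-- T is determined by the part A removed from S and the equally large part added from the
complement, for which there are at most (d-k)^|A| choices. The binomial theorem and 1 + x ≤ exp x
finish. -/
theorem sum_kset_pow_card_sdiff_le {d k : ℕ} (S : KSet d k) {q : ℝ} (hq : 0 ≤ q) :
    ∑ T : KSet d k, q ^ (S.1 \ T.1).card ≤ Real.exp (k * (d - k) * q) := by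
  classical
  have hk : k ≤ d := by
    have := S.1.card_le_univ
    rwa [S.2, Fintype.card_fin] at this
  have hcompl : S.1ᶜ.card = d - k := by rw [Finset.card_compl, S.2, Fintype.card_fin]
  let φ : KSet d k → (Σ _ : Finset (Fin d), Finset (Fin d)) := fun T => ⟨S.1 \ T.1, T.1 \ S.1⟩
  have hφ : Function.Injective φ := by
    intro T T' h
    simp only [φ, Sigma.mk.injEq, heq_eq_eq] at h
    ext a
    have h₁ := Finset.ext_iff.1 h.1 a
    have h₂ := Finset.ext_iff.1 h.2 a
    simp only [Finset.mem_sdiff] at h₁ h₂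
    tauto
  calc ∑ T : KSet d k, q ^ (S.1 \ T.1).card
      = ∑ x ∈ Finset.univ.image φ, q ^ x.1.card :=
        (Finset.sum_image (f := fun x => q ^ x.1.card) hφ.injOn).symm
    _ ≤ ∑ x ∈ S.1.powerset.sigma fun A => Finset.powersetCard A.card S.1ᶜ, q ^ x.1.card := by
        refine Finset.sum_le_sum_of_subset_of_nonneg (fun x hx => ?_) fun _ _ _ => by positivity
        obtain ⟨T, -, rfl⟩ := Finset.mem_image.1 hx
        have hcard : (T.1 \ S.1).card = (S.1 \ T.1).card :=
          Finset.card_sdiff_comm (T.2.trans S.2.symm)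
        simp only [φ, Finset.mem_sigma, Finset.mem_powerset, Finset.mem_powersetCard]
        refine ⟨Finset.sdiff_subset, fun a ha => ?_, hcard⟩
        simp only [Finset.mem_sdiff] at ha
        simpa using ha.2
    _ = ∑ A ∈ S.1.powerset, ((d - k).choose A.card : ℝ) * q ^ A.card := by
        rw [Finset.sum_sigma]
        simp [Finset.card_powersetCard, hcompl]
    _ ≤ ∑ A ∈ S.1.powerset, (((d : ℝ) - k) * q) ^ A.card * 1 ^ (S.1.card - A.card) := by
        refine Finset.sum_le_sum fun A _ => ?_
        rw [one_pow, mul_one, mul_pow, ← Nat.cast_sub hk]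
        gcongr
        exact_mod_cast Nat.choose_le_pow _ _
    _ = (((d : ℝ) - k) * q + 1) ^ k := by rw [Finset.sum_pow_mul_eq_add_pow, S.2]
    _ ≤ Real.exp (((d : ℝ) - k) * q) ^ k := by
        have : (0 : ℝ) ≤ (d : ℝ) - k := sub_nonneg.2 (by exact_mod_cast hk)
        gcongr
        exact Real.add_one_le_exp _
    _ = _ := by
        rw [← Real.exp_nat_mul]
        ring_nf

variable {d k : ℕ}

theorem sum_bicluster_mul (μ ν : ℝ) (j j' : KSet d k × KSet d k) :
    ∑ p, bicluster d k μ j p * bicluster d k ν j' p =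
      μ * ν * (((j.1.1 ∩ j'.1.1).card : ℝ) * ((j.2.1 ∩ j'.2.1).card : ℝ)) := by
  classical
  have h : ∀ p, bicluster d k μ j p * bicluster d k ν j' p =
      if p ∈ (j.1.1 ∩ j'.1.1) ×ˢ (j.2.1 ∩ j'.2.1) then μ * ν else 0 := by
    intro p
    simp only [bicluster, Finset.mem_product, Finset.mem_inter]
    split_ifs <;> first | (exfalso; tauto) | simp
  simp_rw [h]
  rw [Finset.sum_ite_mem, Finset.univ_inter, Finset.sum_const, Finset.card_product, nsmul_eq_mul]
  push_cast
  ring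

/-- Half of the squared distance of two biclusters grows linearly in the number of rows and columns
in which they differ. -/
theorem card_sq_sub_inter_ge (j j' : KSet d k × KSet d k) :
    (k : ℝ) / 2 * (((j.1.1 \ j'.1.1).card + (j.2.1 \ j'.2.1).card : ℕ) : ℝ) ≤
      (k : ℝ) * k - ((j.1.1 ∩ j'.1.1).card : ℝ) * ((j.2.1 ∩ j'.2.1).card : ℝ) := by
  classical
  have h₁ : ((j.1.1 \ j'.1.1).card : ℝ) + ((j.1.1 ∩ j'.1.1).card : ℝ) = k := by
    exact_mod_cast (Finset.card_sdiff_add_card_inter _ _).trans j.1.2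
  have h₂ : ((j.2.1 \ j'.2.1).card : ℝ) + ((j.2.1 ∩ j'.2.1).card : ℝ) = k := by
    exact_mod_cast (Finset.card_sdiff_add_card_inter _ _).trans j.2.2
  have p₁ : (0 : ℝ) ≤ ((j.1.1 \ j'.1.1).card : ℝ) := by positivity
  have p₂ : (0 : ℝ) ≤ ((j.2.1 \ j'.2.1).card : ℝ) := by positivity
  have p₃ : (0 : ℝ) ≤ ((j.1.1 ∩ j'.1.1).card : ℝ) := by positivity
  have p₄ : (0 : ℝ) ≤ ((j.2.1 ∩ j'.2.1).card : ℝ) := by positivity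
  push_cast
  generalize ((j.1.1 \ j'.1.1).card : ℝ) = a at *
  generalize ((j.2.1 \ j'.2.1).card : ℝ) = b at *
  generalize ((j.1.1 ∩ j'.1.1).card : ℝ) = s at *
  generalize ((j.2.1 ∩ j'.2.1).card : ℝ) = r at *
  have hs : s = k - a := by linarith
  have hr : r = k - b := by linarith
  subst hs hr
  -- The difference of the two sides is (a(k-b) + b(k-a))/2.
  nlinarith [mul_nonneg p₁ p₄, mul_nonneg p₂ p₃]

theorem designLaw_const {ι J : Type*} [Fintype ι] (v : J → ι → ℝ) {b : ℝ≥0} (hb : b ≠ 0) (j : J) :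
    designLaw v (fun _ => b) j = Measure.pi fun i => gaussianReal (v j i) b⁻¹ := by
  simp [designLaw, hb]

theorem designLaw_bicluster_pair_error_le {μ : ℝ} (hμ : 0 ≤ μ) {b : ℝ≥0} (hb : b ≠ 0)
    (j j' : KSet d k × KSet d k) :
    designLaw (bicluster d k μ) (fun _ => b) j
        {y | ∑ p, bicluster d k 1 j p * y p ≤ ∑ p, bicluster d k 1 j' p * y p} ≤
      ENNReal.ofReal (Real.exp (-(μ ^ 2 * b * k / 8)) ^
        ((j.1.1 \ j'.1.1).card + (j.2.1 \ j'.2.1).card)) := by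
  have hb' : (b : ℝ) ≠ 0 := by exact_mod_cast hb
  rw [designLaw_const _ hb]
  set N : ℝ := (k : ℝ) * k - ((j.1.1 ∩ j'.1.1).card : ℝ) * ((j.2.1 ∩ j'.2.1).card : ℝ) with hN
  have hset : {y : Fin d × Fin d → ℝ |
      ∑ p, bicluster d k 1 j p * y p ≤ ∑ p, bicluster d k 1 j' p * y p} =
      {y | 0 ≤ ∑ p, (bicluster d k 1 j' p - bicluster d k 1 j p) * y p} := by
    ext y
    simp [sub_mul, Finset.sum_sub_distrib]
  rw [hset]
  -- This t minimizes the Chernoff exponent -tμN + t²N/b, with value -μ²bN/4.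
  refine (pi_gaussianReal_halfspace_le (bicluster d k μ j) b⁻¹ _
    (t := μ * b / 2) (by positivity)).trans ?_
  have hself : ∀ (α β : ℝ) (i : KSet d k × KSet d k),
      ∑ p, bicluster d k α i p * bicluster d k β i p = α * β * (k * k) := by
    intro α β i
    rw [sum_bicluster_mul, Finset.inter_self, Finset.inter_self, i.1.2, i.2.2]
  have hlin : ∑ p, (bicluster d k 1 j' p - bicluster d k 1 j p) * bicluster d k μ j p =
      -(μ * N) := by
    simp only [sub_mul, Finset.sum_sub_distrib]
    rw [hself, sum_bicluster_mul, Finset.inter_comm j'.1.1, Finset.inter_comm j'.2.1, hN]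
    ring
  have hsq : ∑ p, (bicluster d k 1 j' p - bicluster d k 1 j p) ^ 2 = 2 * N := by
    have : ∀ p, (bicluster d k 1 j' p - bicluster d k 1 j p) ^ 2 =
        bicluster d k 1 j' p * bicluster d k 1 j' p + bicluster d k 1 j p * bicluster d k 1 j p
          - 2 * (bicluster d k 1 j p * bicluster d k 1 j' p) := fun p => by ring
    simp_rw [this]
    rw [Finset.sum_sub_distrib, Finset.sum_add_distrib, ← Finset.mul_sum, hself, hself,
      sum_bicluster_mul, hN]
    ring
  rw [hlin, hsq, ← Real.exp_nat_mul]
  refine ENNReal.ofReal_le_ofReal (Real.exp_le_exp.2 ?_)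
  have hge := card_sq_sub_inter_ge j j'
  rw [← hN] at hge
  have hexp : μ * b / 2 * -(μ * N) + ((b⁻¹ : ℝ≥0) : ℝ) * (μ * b / 2) ^ 2 / 2 * (2 * N) =
      -(μ ^ 2 * b / 4 * N) := by
    push_cast
    field_simp
    ring
  rw [hexp]
  have hmul := mul_le_mul_of_nonneg_left hge (show 0 ≤ μ ^ 2 * b / 4 by positivity)
  linarith

/-- Under uniform sampling with precision `b`, the estimator that maximizes the sum of the
observations over the bicluster has small risk. -/
theorem minimaxRisk_designLaw_const_le (hkd : k ≤ d) {μ : ℝ} (hμ : 0 ≤ μ) {b : ℝ≥0} (hb : b ≠ 0) :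
    minimaxRisk (designLaw (bicluster d k μ) fun _ => b) ≤
      ENNReal.ofReal
        (Real.exp (2 * (k * (d - k) * Real.exp (-(μ ^ 2 * b * k / 8)))) - 1) := by
  classical
  have := nonempty_kset hkd
  set q := Real.exp (-(μ ^ 2 * b * k / 8)) with hq
  have hq0 : 0 ≤ q := (Real.exp_pos _).le
  obtain ⟨T, hT, hmax⟩ := exists_measurable_argmax
    (fun (j : KSet d k × KSet d k) (y : Fin d × Fin d → ℝ) => ∑ p, bicluster d k 1 j p * y p)
    (fun j => by fun_prop)
  refine (iInf₂_le T hT).trans (iSup_le fun j => ?_)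
  let r : KSet d k × KSet d k → ℝ := fun j' =>
    q ^ ((j.1.1 \ j'.1.1).card + (j.2.1 \ j'.2.1).card)
  have hr : ∀ j', 0 ≤ r j' := fun j' => by positivity
  calc designLaw (bicluster d k μ) (fun _ => b) j {y | T y ≠ j}
      ≤ designLaw (bicluster d k μ) (fun _ => b) j (⋃ j' ∈ Finset.univ.erase j,
        {y | ∑ p, bicluster d k 1 j p * y p ≤ ∑ p, bicluster d k 1 j' p * y p}) := by
        refine measure_mono fun y hy => ?_
        exact Set.mem_iUnion₂.2 ⟨T y, Finset.mem_erase.2 ⟨hy, Finset.mem_univ _⟩, hmax y j⟩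
    _ ≤ ∑ j' ∈ Finset.univ.erase j, ENNReal.ofReal (r j') :=
        (measure_biUnion_finset_le _ _).trans
          (Finset.sum_le_sum fun j' _ => designLaw_bicluster_pair_error_le hμ hb j j')
    _ = ENNReal.ofReal (∑ j' ∈ Finset.univ.erase j, r j') :=
        (ENNReal.ofReal_sum_of_nonneg fun j' _ => hr j').symm
    _ ≤ _ := by
        refine ENNReal.ofReal_le_ofReal ?_
        have hsum : ∑ j', r j' ≤ Real.exp (2 * (k * (d - k) * q)) := by
          simp only [r, pow_add]
          rw [Fintype.sum_prod_type]
          simp only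
          rw [← Finset.sum_mul_sum, two_mul, Real.exp_add]
          exact mul_le_mul (sum_kset_pow_card_sdiff_le _ hq0) (sum_kset_pow_card_sdiff_le _ hq0)
            (Finset.sum_nonneg fun _ _ => by positivity) (Real.exp_pos _).le
        -- The union bound omits the true index, whose term is 1; this is the `- 1` in the bound.
        have hj : r j = 1 := by simp [r]
        rw [← Finset.add_sum_erase _ _ (Finset.mem_univ j), hj] at hsum
        linarith

end UpperBound

/-! ### Lower bound: second moments against a reference law -/

section LowerBound

/-- Truncation at level t: pointwise L ≤ t + L²/t, according to whether L is below or above t. -/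
theorem withDensity_apply_le_of_second_moment {Ω : Type*} [MeasurableSpace Ω] (Q : Measure Ω)
    {L : Ω → ℝ≥0∞} (hL : Measurable L) {C t : ℝ≥0∞} (hC : ∫⁻ y, L y ^ 2 ∂Q ≤ C) (ht : t ≠ 0)
    (ht' : t ≠ ∞) {A : Set Ω} (hA : MeasurableSet A) :
    Q.withDensity L A ≤ t * Q A + C / t := by
  rw [withDensity_apply _ hA]
  calc ∫⁻ y in A, L y ∂Q ≤ ∫⁻ y in A, (t + L y ^ 2 / t) ∂Q := by
        refine lintegral_mono fun y => ?_
        rcases le_total (L y) t with h | h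
        · exact h.trans le_self_add
        · refine le_trans ?_ le_add_self
          rw [ENNReal.le_div_iff_mul_le (Or.inl ht) (Or.inl ht'), sq]
          gcongr
    _ = t * Q A + ∫⁻ y in A, L y ^ 2 / t ∂Q := by
        rw [lintegral_add_left measurable_const, setLIntegral_const]
    _ ≤ t * Q A + ∫⁻ y, L y ^ 2 / t ∂Q := by
        gcongr
        exact Measure.restrict_le_self
    _ ≤ t * Q A + C / t := by
        simp_rw [div_eq_mul_inv]
        rw [lintegral_mul_const _ (hL.pow_const 2)]
        gcongr

theorem maxRisk_le_one {Ω J : Type*} [MeasurableSpace Ω] (P : J → Measure Ω)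
    [∀ j, IsProbabilityMeasure (P j)] (T : Ω → J) : maxRisk P T ≤ 1 :=
  iSup_le fun _ => prob_le_one

theorem minimaxRisk_le_one {Ω J : Type*} [MeasurableSpace Ω] [Nonempty J] (P : J → Measure Ω)
    [∀ j, IsProbabilityMeasure (P j)] : minimaxRisk P ≤ 1 :=
  (iInf₂_le (fun _ => Classical.arbitrary J) (@measurable_const _ _ ⊤ _ _)).trans
    (maxRisk_le_one P _)

/-- If `M` of the laws have second moment at most `C` with respect to a common law, then no
estimator identifies the index with probability above `(1 + C) / √M`. -/
theorem minimaxRisk_ge_of_second_moment {Ω J A : Type*} [MeasurableSpace Ω] [Fintype A] [Nonempty A]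
    (P : J → Measure Ω) [∀ j, IsProbabilityMeasure (P j)] (Q : Measure Ω) [IsProbabilityMeasure Q]
    {F : A → J} (hF : F.Injective) {L : A → Ω → ℝ≥0∞} (hL : ∀ a, Measurable (L a))
    (hP : ∀ a, P (F a) = Q.withDensity (L a)) {C : ℝ} (hC0 : 0 ≤ C)
    (hC : ∀ a, ∫⁻ y, L a y ^ 2 ∂Q ≤ ENNReal.ofReal C) :
    ENNReal.ofReal (1 - (1 + C) / √(Fintype.card A)) ≤ minimaxRisk P := by
  refine le_iInf₂ fun T hT => ENNReal.ofReal_le_of_le_toReal ?_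
  have hM : (0 : ℝ) < Fintype.card A := by exact_mod_cast Fintype.card_pos
  set M : ℝ := ((Fintype.card A : ℕ) : ℝ) with hMdef
  -- Truncating at √M balances the two errors: after averaging over the M hypotheses they are at
  -- most 1/√M and C/√M.
  have ht : 0 < √M := Real.sqrt_pos.2 hM
  have hTm := fun a => measurableSet_eq_of_measurable_top hT (F a)
  have hfin : maxRisk P T ≠ ∞ := ne_top_of_le_ne_top ENNReal.one_ne_top (maxRisk_le_one P T)
  have hlow : ∀ a, 1 - (maxRisk P T).toReal ≤ (P (F a)).real {y | T y = F a} := by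
    intro a
    have h₁ : (P (F a)).real {y | T y = F a}ᶜ ≤ (maxRisk P T).toReal :=
      ENNReal.toReal_mono hfin (le_iSup (fun j => P j {y | T y ≠ j}) (F a))
    rw [probReal_compl_eq_one_sub (hTm a)] at h₁
    linarith
  have hup : ∀ a, (P (F a)).real {y | T y = F a} ≤ √M * Q.real {y | T y = F a} + C / √M := by
    intro a
    have h := withDensity_apply_le_of_second_moment Q (hL a) (hC a)
      (ENNReal.ofReal_pos.2 ht).ne' ENNReal.ofReal_ne_top (hTm a)
    rw [← hP a, ← ofReal_measureReal (μ := Q), ← ENNReal.ofReal_mul ht.le, ← ENNReal.ofReal_div_of_pos ht,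
      ← ENNReal.ofReal_add (by positivity) (by positivity)] at h
    exact ENNReal.toReal_le_of_le_ofReal (by positivity) h
  -- The events are disjoint, so under the single law Q they share total mass at most one.
  have hQ : ∑ a, Q.real {y | T y = F a} ≤ 1 := by
    rw [← measureReal_iUnion_fintype (fun a b hab => ?_) hTm]
    · exact measureReal_le_one
    · refine Set.disjoint_left.2 fun y hy hy' => hab (hF ?_)
      exact (show T y = F a from hy).symm.trans hy'
  have hsum : M * (1 - (maxRisk P T).toReal) ≤ √M + M * (C / √M) :=
    calc M * (1 - (maxRisk P T).toReal) = ∑ _a : A, (1 - (maxRisk P T).toReal) := by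
          rw [Finset.sum_const, nsmul_eq_mul, Finset.card_univ]
      _ ≤ ∑ a, (√M * Q.real {y | T y = F a} + C / √M) :=
          Finset.sum_le_sum fun a _ => (hlow a).trans (hup a)
      _ = √M * ∑ a, Q.real {y | T y = F a} + M * (C / √M) := by
          rw [Finset.sum_add_distrib, ← Finset.mul_sum]
          simp [hMdef]
      _ ≤ √M + M * (C / √M) := by
          nlinarith
  have hsq : √M * √M = M := Real.mul_self_sqrt hM.le
  have hdiv : M * ((1 + C) / √M) = √M + M * (C / √M) := by
    have : M / √M = √M := by rw [div_eq_iff ht.ne', hsq]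
    rw [add_div, mul_add, mul_one_div, this]
  rw [← hdiv] at hsum
  linarith [le_of_mul_le_mul_left hsum hM]

section DesignLaw

variable {ι J : Type*} [Fintype ι]

instance (v : J → ι → ℝ) (B : ι → ℝ≥0) (j : J) : IsProbabilityMeasure (designLaw v B j) := by
  have : ∀ i, IsProbabilityMeasure
      (if B i = 0 then Measure.dirac 0 else gaussianReal (v j i) (B i)⁻¹) := fun i => by
    split_ifs <;> infer_instance
  unfold designLaw
  infer_instance

theorem isotropicLaw_eq_designLaw (v : J → ι → ℝ) : isotropicLaw v = designLaw v fun _ => 1 := by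
  ext1 j
  rw [designLaw_const v one_ne_zero, inv_one, isotropicLaw]

/-- The density of one coordinate under mean `m` with respect to mean `w`, at precision `b`. -/
noncomputable def coordinateRatio (w m : ℝ) (b : ℝ≥0) (x : ℝ) : ℝ≥0∞ :=
  if b = 0 then 1 else ENNReal.ofReal (gaussianRatio w m b⁻¹ x)

theorem measurable_coordinateRatio (w m : ℝ) (b : ℝ≥0) : Measurable (coordinateRatio w m b) := by
  unfold coordinateRatio
  split_ifs
  exacts [measurable_const, (measurable_gaussianRatio _ _ _).ennreal_ofReal]

/-- An unobserved coordinate has law δ₀ whatever its mean, so its ratio is 1. Indexing by `Unit`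
allows a reference mean w outside the family. -/
theorem designLaw_eq_withDensity (v : J → ι → ℝ) (w : ι → ℝ) (B : ι → ℝ≥0) (j : J) :
    designLaw v B j = (designLaw (fun _ : Unit => w) B ()).withDensity
      (fun y => ∏ i, coordinateRatio (w i) (v j i) (B i) (y i)) := by
  have hprob : ∀ (m : ι → ℝ) i, IsProbabilityMeasure
      (if B i = 0 then Measure.dirac 0 else gaussianReal (m i) (B i)⁻¹) := fun m i => by
    split_ifs <;> infer_instance
  have := hprob w
  have := hprob (v j)
  refine pi_withDensity _ _ (fun i => coordinateRatio (w i) (v j i) (B i))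
    (fun i => measurable_coordinateRatio _ _ _) fun i => ?_
  split_ifs with h
  · rw [show coordinateRatio (w i) (v j i) (B i) = 1 from funext fun x => if_pos h,
      withDensity_one]
  · rw [show coordinateRatio (w i) (v j i) (B i) =
        fun x => ENNReal.ofReal (gaussianRatio (w i) (v j i) (B i)⁻¹ x) from
        funext fun x => if_neg h]
    exact gaussianReal_eq_withDensity_ratio _ _ (inv_ne_zero h)

theorem lintegral_sq_designLaw_density (v : J → ι → ℝ) (w : ι → ℝ) (B : ι → ℝ≥0) (j : J) :
    ∫⁻ y, (∏ i, coordinateRatio (w i) (v j i) (B i) (y i)) ^ 2 ∂designLaw (fun _ : Unit => w) B () =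
      ENNReal.ofReal (Real.exp (∑ i, B i * (v j i - w i) ^ 2)) := by
  have : ∀ i, IsProbabilityMeasure
      (if B i = 0 then Measure.dirac 0 else gaussianReal (w i) (B i)⁻¹) := fun i => by
    split_ifs <;> infer_instance
  simp_rw [← Finset.prod_pow]
  rw [designLaw, lintegral_pi_prod _ (fun i x => coordinateRatio (w i) (v j i) (B i) x ^ 2)
    (fun i => (measurable_coordinateRatio _ _ _).pow_const 2), Real.exp_sum,
    ENNReal.ofReal_prod_of_nonneg fun i _ => (Real.exp_pos _).le]
  refine Finset.prod_congr rfl fun i _ => ?_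
  simp only [coordinateRatio]
  split_ifs with h
  · simp [h]
  · rw [lintegral_sq_gaussianRatio _ _ (inv_ne_zero h)]
    congr 2
    push_cast
    rw [div_inv_eq_mul, mul_comm]

end DesignLaw

variable {d k : ℕ}

/-- Average over the d cyclic shifts of one k-set: each element is covered by exactly k of them. -/
theorem exists_kset_sum_le (hk : k < d) (c : Fin d → ℝ) :
    ∃ S : KSet d k, d * ∑ b ∈ S.1, c b ≤ k * ∑ b, c b := by
  have : NeZero d := ⟨by omega⟩
  obtain ⟨S₀⟩ := nonempty_kset hk.le
  have hmap : ∀ r, ∑ b ∈ (ksetPerm (Equiv.addRight r) S₀).1, c b = ∑ b ∈ S₀.1, c (b + r) := by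
    intro r
    simp [ksetPerm]
  have htot : ∑ r : Fin d, (d : ℝ) * ∑ b ∈ (ksetPerm (Equiv.addRight r) S₀).1, c b =
      ∑ _r : Fin d, (k : ℝ) * ∑ b, c b := by
    simp_rw [hmap]
    rw [← Finset.mul_sum, Finset.sum_comm]
    have : ∀ b, ∑ r, c (b + r) = ∑ r, c r := fun b => Equiv.sum_comp (Equiv.addLeft b) c
    simp [this, S₀.2]
  obtain ⟨r, -, hr⟩ := Finset.exists_le_of_sum_le
    (Finset.univ_nonempty (α := Fin d)) htot.le
  exact ⟨_, hr⟩

/-- All but a quarter of the rows carry at most four times the average weight. -/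
theorem four_mul_card_heavy_le {r : Fin d → ℝ} (hr : ∀ a, 0 ≤ r a) {s : ℝ} (hs : 0 < s)
    (hsum : ∑ a, r a ≤ s) :
    4 * (Finset.univ.filter fun a => ¬ r a ≤ 4 * s / d).card ≤ d := by
  rcases Nat.eq_zero_or_pos d with rfl | hd
  · simp
  have hd' : (0 : ℝ) < d := by exact_mod_cast hd
  set n := (Finset.univ.filter fun a => ¬ r a ≤ 4 * s / d).card with hn
  have h : (n : ℝ) * (4 * s / d) ≤ s := by
    rw [← nsmul_eq_mul, hn]
    refine (Finset.card_nsmul_le_sum _ r _ fun a ha => ?_).trans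
      ((Finset.sum_le_sum_of_subset_of_nonneg (Finset.filter_subset _ _)
        fun a _ _ => hr a).trans hsum)
    exact (not_le.1 (Finset.mem_filter.1 ha).2).le
  have h2 : ((4 * n : ℕ) : ℝ) ≤ d := by
    push_cast
    have : (n : ℝ) * (4 * s / d) = 4 * n / d * s := by ring
    rw [this] at h
    have h3 : 4 * (n : ℝ) / d ≤ 1 := le_of_mul_le_mul_right (by linarith) hs
    rwa [div_le_one hd'] at h3
  exact_mod_cast h2

/-- Sets of size `k` obtained from one set by adding, or removing, one of many elements. -/
theorem exists_symmDiff_singleton_card (hk : 1 ≤ k) (hkd : k < d) (U : Finset (Fin d))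
    (hU : 4 * Uᶜ.card ≤ d) :
    ∃ S₀ : Finset (Fin d), ∃ I ⊆ U, d ≤ 4 * I.card ∧ ∀ a ∈ I, (symmDiff S₀ {a}).card = k := by
  have hcard : U.card + Uᶜ.card = d := by simp
  -- Adding an element to a (k-1)-set leaves enough choices when k ≤ d/2; otherwise an element is
  -- removed from a (k+1)-set. Either way at least 3d/4 - d/2 choices lie in U.
  rcases le_or_gt (2 * k) d with h | h
  · obtain ⟨S₀⟩ := nonempty_kset (d := d) (k := k - 1) (by omega)
    refine ⟨S₀.1, U \ S₀.1, Finset.sdiff_subset, ?_, fun a ha => ?_⟩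
    · have := Finset.le_card_sdiff S₀.1 U
      have := S₀.2
      omega
    · have ha' : a ∉ S₀.1 := (Finset.mem_sdiff.1 ha).2
      rw [(Finset.disjoint_singleton_right.2 ha').symmDiff_eq_sup, Finset.sup_eq_union,
        Finset.card_union_of_disjoint (Finset.disjoint_singleton_right.2 ha'), S₀.2,
        Finset.card_singleton]
      omega
  · obtain ⟨S₀⟩ := nonempty_kset (d := d) (k := k + 1) (by omega)
    refine ⟨S₀.1, U ∩ S₀.1, Finset.inter_subset_left, ?_, fun a ha => ?_⟩
    · have h₁ := Finset.card_union_add_card_inter U S₀.1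
      have h₂ : (U ∪ S₀.1).card ≤ d := by simpa using (U ∪ S₀.1).card_le_univ
      have := S₀.2
      omega
    · have ha' : {a} ⊆ S₀.1 := Finset.singleton_subset_iff.2 (Finset.mem_inter.1 ha).2
      rw [symmDiff_of_ge ha', Finset.card_sdiff_of_subset ha', S₀.2, Finset.card_singleton]
      omega

/-- No estimator recovers the bicluster under a budget `τ` that is small compared with
`d² log d / (μ² k)`. -/
theorem minimaxRisk_designLaw_ge (hk : 1 ≤ k) (hkd : k < d) (μ : ℝ) {τ : ℝ} (hτ : 0 < τ)
    (B : Fin d × Fin d → ℝ≥0) (hB : ∑ p, (B p : ℝ) ≤ τ) :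
    ENNReal.ofReal (1 - 2 * (1 + Real.exp (4 * (μ ^ 2 * (τ * k / d ^ 2)))) / √d) ≤
      minimaxRisk (designLaw (bicluster d k μ) B) := by
  classical
  have hd : (0 : ℝ) < d := by exact_mod_cast (by omega : 0 < d)
  have hk' : (0 : ℝ) < k := by exact_mod_cast hk
  obtain ⟨S', hS'⟩ := exists_kset_sum_le hkd fun b => ∑ a, (B (a, b) : ℝ)
  let r : Fin d → ℝ := fun a => ∑ b ∈ S'.1, (B (a, b) : ℝ)
  have hr : ∀ a, 0 ≤ r a := fun a => Finset.sum_nonneg fun b _ => NNReal.coe_nonneg _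
  have hrsum : ∑ a, r a ≤ k * τ / d := by
    rw [le_div_iff₀ hd, mul_comm]
    simp only [r]
    rw [Finset.sum_comm]
    refine hS'.trans ?_
    rw [Finset.sum_comm, ← Fintype.sum_prod_type' (f := fun a b => (B (a, b) : ℝ))]
    gcongr
  set U := Finset.univ.filter fun a => r a ≤ 4 * (k * τ / d) / d with hU
  have hUc : 4 * Uᶜ.card ≤ d := by
    rw [hU, Finset.compl_filter]
    exact four_mul_card_heavy_le hr (by positivity) hrsum
  obtain ⟨S₀, I, hIU, hI, hcard⟩ := exists_symmDiff_singleton_card hk hkd U hUc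
  have hIpos : 0 < I.card := by omega
  have : Nonempty I := (Finset.card_pos.1 hIpos).to_subtype
  let F : I → KSet d k × KSet d k := fun a => (⟨symmDiff S₀ {a.1}, hcard a.1 a.2⟩, S')
  have hF : F.Injective := by
    intro a a' h
    have h' : symmDiff S₀ {a.1} = symmDiff S₀ {a'.1} := congrArg (fun x => x.1.1) h
    exact Subtype.ext (Finset.singleton_injective (symmDiff_right_injective S₀ h'))
  -- Since |S₀| = k ± 1, the reference mean is not itself a hypothesis; it differs from the
  -- hypothesis of a only in row a, on the columns S'.
  let w : Fin d × Fin d → ℝ := fun p => if p.1 ∈ S₀ ∧ p.2 ∈ S'.1 then μ else 0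
  have hdist : ∀ a : I, ∑ p, (B p : ℝ) * (bicluster d k μ (F a) p - w p) ^ 2 = μ ^ 2 * r a.1 := by
    intro a
    have h : ∀ p : Fin d × Fin d, (B p : ℝ) * (bicluster d k μ (F a) p - w p) ^ 2 =
        if p.1 = a.1 then (if p.2 ∈ S'.1 then μ ^ 2 * B p else 0) else 0 := by
      rintro ⟨x, y⟩
      simp only [bicluster, w, F, Finset.mem_symmDiff, Finset.mem_singleton]
      by_cases hx : x = a.1 <;> by_cases hy : y ∈ S'.1 <;> by_cases hx0 : x ∈ S₀ <;>
        simp_all [mul_comm]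
    simp_rw [h]
    rw [Fintype.sum_prod_type]
    simp only
    rw [Finset.sum_eq_single a.1]
    · simp only [if_true, r, Finset.mul_sum]
      rw [Finset.sum_ite_mem, Finset.univ_inter]
    · intro x _ hx
      simp [hx]
    · simp
  have hmain := minimaxRisk_ge_of_second_moment (designLaw (bicluster d k μ) B)
    (designLaw (fun _ : Unit => w) B ()) hF
    (L := fun a y => ∏ p, coordinateRatio (w p) (bicluster d k μ (F a) p) (B p) (y p))
    (fun a => Finset.measurable_prod _ fun p _ =>
      (measurable_coordinateRatio _ _ _).comp (measurable_pi_apply p))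
    (fun a => designLaw_eq_withDensity _ w B (F a))
    (C := Real.exp (4 * (μ ^ 2 * (τ * k / d ^ 2)))) (Real.exp_pos _).le (fun a => by
      rw [lintegral_sq_designLaw_density, hdist]
      refine ENNReal.ofReal_le_ofReal (Real.exp_le_exp.2 ?_)
      have ha : r a.1 ≤ 4 * (k * τ / d) / d := (Finset.mem_filter.1 (hIU a.2)).2
      calc μ ^ 2 * r a.1 ≤ μ ^ 2 * (4 * (k * τ / d) / d) := by gcongr
        _ = _ := by field_simp)
  refine le_trans (ENNReal.ofReal_le_ofReal ?_) hmain
  have hsqrt : √d / 2 ≤ √(Fintype.card I : ℝ) := by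
    refine Real.le_sqrt_of_sq_le ?_
    rw [div_pow, Real.sq_sqrt hd.le, Fintype.card_coe]
    have : (d : ℝ) ≤ 4 * I.card := by exact_mod_cast hI
    linarith
  have hsd : 0 < √(d : ℝ) := Real.sqrt_pos.2 hd
  have : (1 + Real.exp (4 * (μ ^ 2 * (τ * k / d ^ 2)))) / √(Fintype.card I : ℝ) ≤
      2 * (1 + Real.exp (4 * (μ ^ 2 * (τ * k / d ^ 2)))) / √d := by
    rw [show ∀ x : ℝ, 2 * x / √d = x / (√d / 2) from fun x => by field_simp]
    gcongr
  linarith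

end LowerBound

/-! ### From the bounds to the minimax rates -/

section Rates

variable {d k : ℕ → ℕ}

/-- The difference is (k-1)(d-k-1) ≥ 0. -/
theorem sub_one_le_mul_sub {k d : ℕ} (hk : 1 ≤ k) (hkd : k < d) :
    (d : ℝ) - 1 ≤ k * ((d : ℝ) - k) := by
  have h₁ : (1 : ℝ) ≤ k := by exact_mod_cast hk
  have h₂ : (k : ℝ) + 1 ≤ d := by exact_mod_cast hkd
  nlinarith

theorem one_le_mul_sub {k d : ℕ} (hk : 1 ≤ k) (hkd : k < d) : (1 : ℝ) ≤ k * ((d : ℝ) - k) := by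
  have h₁ : (1 : ℝ) ≤ k := by exact_mod_cast hk
  have h₂ : (k : ℝ) + 1 ≤ d := by exact_mod_cast hkd
  nlinarith

theorem log_mul_sub_le {k d : ℕ} (hk : 1 ≤ k) (hkd : k < d) :
    Real.log (k * ((d : ℝ) - k)) ≤ 2 * Real.log d := by
  have h₀ := one_le_mul_sub hk hkd
  have h₂ : (k : ℝ) ≤ d := by exact_mod_cast hkd.le
  have h₃ : (0 : ℝ) ≤ k := by positivity
  rw [show (2 : ℝ) * Real.log d = Real.log ((d : ℝ) ^ 2) by rw [Real.log_pow]; norm_num]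
  refine Real.log_le_log (by linarith) ?_
  nlinarith

/-- The non-asymptotic bounds on the risk determine the minimax rate. -/
theorem isMinimaxRate_of_bounds (hk : ∀ n, 1 ≤ k n) (hkd : ∀ n, k n < d n)
    (hd : Tendsto d atTop atTop) {τ : ℕ → ℝ} (hτ : ∀ n, 0 < τ n) {R : ℕ → ℝ → ℝ≥0∞}
    (hone : ∀ n μ, R n μ ≤ 1)
    (hupper : ∀ n μ, 0 ≤ μ → R n μ ≤ ENNReal.ofReal (Real.exp (2 * (k n * (d n - k n) *
      Real.exp (-(μ ^ 2 * (τ n * k n / d n ^ 2) / 8)))) - 1))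
    (hlower : ∀ n μ, ENNReal.ofReal
      (1 - 2 * (1 + Real.exp (4 * (μ ^ 2 * (τ n * k n / d n ^ 2)))) / √(d n)) ≤ R n μ) :
    IsMinimaxRate R fun n => √((d n : ℝ) ^ 2 / (τ n * (k n : ℝ)) *
      Real.log ((k n : ℝ) * ((d n : ℝ) - (k n : ℝ)))) := by
  intro μ hμ
  have hdR : Tendsto (fun n => (d n : ℝ)) atTop atTop := tendsto_natCast_atTop_atTop.comp hd
  have hdpos : ∀ n, (0 : ℝ) < d n := fun n => by
    exact_mod_cast (Nat.zero_le _).trans_lt (hkd n)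
  have hkpos : ∀ n, (0 : ℝ) < k n := fun n => by exact_mod_cast hk n
  have hτk : ∀ n, 0 < τ n * (k n : ℝ) / (d n : ℝ) ^ 2 := fun n =>
    div_pos (mul_pos (hτ n) (hkpos n)) (pow_pos (hdpos n) 2)
  have hlog : ∀ n, 0 ≤ Real.log ((k n : ℝ) * ((d n : ℝ) - (k n : ℝ))) := fun n =>
    Real.log_nonneg (one_le_mul_sub (hk n) (hkd n))
  set g : ℕ → ℝ := fun n => √((d n : ℝ) ^ 2 / (τ n * (k n : ℝ)) *
    Real.log ((k n : ℝ) * ((d n : ℝ) - (k n : ℝ)))) with hg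
  have hg0 : ∀ n, 0 ≤ g n := fun n => Real.sqrt_nonneg _
  have hgsq : ∀ n, g n ^ 2 * (τ n * k n / d n ^ 2) =
      Real.log ((k n : ℝ) * ((d n : ℝ) - (k n : ℝ))) := fun n => by
    rw [hg, Real.sq_sqrt (mul_nonneg (div_nonneg (sq_nonneg _)
      (mul_pos (hτ n) (hkpos n)).le) (hlog n))]
    have h₁ := (hτ n).ne'
    have h₂ := (hkpos n).ne'
    have h₃ := (hdpos n).ne'
    field_simp
  constructor
  · intro h
    have hinv : Tendsto (fun n => ((d n : ℝ) - 1)⁻¹) atTop (𝓝 0) :=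
      tendsto_inv_atTop_zero.comp (tendsto_atTop_add_const_right _ (-1) hdR)
    have hbound : Tendsto (fun n => ENNReal.ofReal (Real.exp (2 * ((d n : ℝ) - 1)⁻¹) - 1))
        atTop (𝓝 0) := by
      have := (Real.continuous_exp.tendsto _).comp (hinv.const_mul 2)
      simpa using ENNReal.tendsto_ofReal (this.sub_const 1)
    refine tendsto_of_tendsto_of_tendsto_of_le_of_le' tendsto_const_nhds hbound
      (Eventually.of_forall fun n => zero_le) ?_
    -- With g ≤ μ/4 the exponent μ²s/8 is at least 2 log A. One factor 1/A cancels the A in the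
    -- bound, and the other is at most 1/(d-1), which tends to 0.
    filter_upwards [h.def (show (0 : ℝ) < 1 / 4 by norm_num), hd.eventually_ge_atTop 2]
      with n hn hd2
    rw [Real.norm_of_nonneg (hg0 n), Real.norm_of_nonneg (hμ n)] at hn
    refine (hupper n (μ n) (hμ n)).trans (ENNReal.ofReal_le_ofReal ?_)
    have hx : 16 * Real.log ((k n : ℝ) * ((d n : ℝ) - (k n : ℝ))) ≤
        μ n ^ 2 * (τ n * k n / d n ^ 2) := by
      have hsq : 16 * g n ^ 2 ≤ μ n ^ 2 := by nlinarith [hg0 n, hμ n]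
      rw [← hgsq n, ← mul_assoc]
      exact mul_le_mul_of_nonneg_right hsq (hτk n).le
    have hA := one_le_mul_sub (hk n) (hkd n)
    have hd1 : (0 : ℝ) < (d n : ℝ) - 1 := by
      have : (2 : ℝ) ≤ d n := by exact_mod_cast hd2
      linarith
    have hexp : Real.exp (-(μ n ^ 2 * (τ n * k n / d n ^ 2) / 8)) ≤
        ((k n : ℝ) * ((d n : ℝ) - (k n : ℝ)))⁻¹ * ((d n : ℝ) - 1)⁻¹ := by
      calc Real.exp (-(μ n ^ 2 * (τ n * k n / d n ^ 2) / 8))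
          ≤ Real.exp (-Real.log ((k n : ℝ) * ((d n : ℝ) - (k n : ℝ))) +
            -Real.log ((k n : ℝ) * ((d n : ℝ) - (k n : ℝ)))) := Real.exp_le_exp.2 (by linarith)
        _ = ((k n : ℝ) * ((d n : ℝ) - (k n : ℝ)))⁻¹ *
            ((k n : ℝ) * ((d n : ℝ) - (k n : ℝ)))⁻¹ := by
            rw [Real.exp_add, Real.exp_neg, Real.exp_log (by linarith)]
        _ ≤ _ := by
            refine mul_le_mul_of_nonneg_left ?_ (inv_nonneg.2 (by linarith))
            exact inv_anti₀ hd1 (sub_one_le_mul_sub (hk n) (hkd n))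
    have hmul := mul_le_mul_of_nonneg_left hexp (show 0 ≤ (k n : ℝ) * ((d n : ℝ) - (k n : ℝ)) by
      linarith)
    rw [← mul_assoc, mul_inv_cancel₀ (by linarith), one_mul] at hmul
    gcongr
  · intro h
    have hexp0 : Tendsto (fun n => Real.exp (-(Real.log (d n) / 4))) atTop (𝓝 0) :=
      Real.tendsto_exp_neg_atTop_nhds_zero.comp
        ((Real.tendsto_log_atTop.comp hdR).atTop_div_const (by norm_num))
    have hbound : Tendsto (fun n => ENNReal.ofReal (1 - 4 * Real.exp (-(Real.log (d n) / 4))))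
        atTop (𝓝 1) := by
      simpa using ENNReal.tendsto_ofReal ((hexp0.const_mul 4).const_sub 1)
    refine tendsto_of_tendsto_of_tendsto_of_le_of_le' hbound tendsto_const_nhds ?_
      (Eventually.of_forall fun n => hone n (μ n))
    -- With μ ≤ g/6, 4μ²s ≤ (log A)/9 ≤ (2/9) log d ≤ (log d)/4. So C ≤ d^(1/4), which √d dominates.
    filter_upwards [h.def (show (0 : ℝ) < 1 / 6 by norm_num)] with n hn
    rw [Real.norm_of_nonneg (hg0 n), Real.norm_of_nonneg (hμ n)] at hn
    refine le_trans (ENNReal.ofReal_le_ofReal ?_) (hlower n (μ n))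
    have hx : 36 * (μ n ^ 2 * (τ n * k n / d n ^ 2)) ≤
        Real.log ((k n : ℝ) * ((d n : ℝ) - (k n : ℝ))) := by
      have hsq : 36 * μ n ^ 2 ≤ g n ^ 2 := by nlinarith [hg0 n, hμ n]
      rw [← hgsq n, ← mul_assoc]
      exact mul_le_mul_of_nonneg_right hsq (hτk n).le
    have hl := log_mul_sub_le (hk n) (hkd n)
    have hlogd : 0 ≤ Real.log (d n) := by linarith [hlog n]
    have he : Real.exp (4 * (μ n ^ 2 * (τ n * k n / d n ^ 2))) ≤ Real.exp (Real.log (d n) / 4) :=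
      Real.exp_le_exp.2 (by linarith)
    have he1 : 1 ≤ Real.exp (Real.log (d n) / 4) := Real.one_le_exp (by positivity)
    have hsqrt : √(d n : ℝ) = Real.exp (Real.log (d n) / 2) := by
      rw [Real.sqrt_eq_rpow, Real.rpow_def_of_pos (hdpos n)]
      ring_nf
    have hfrac : 2 * (1 + Real.exp (4 * (μ n ^ 2 * (τ n * k n / d n ^ 2)))) / √(d n) ≤
        4 * Real.exp (-(Real.log (d n) / 4)) := by
      rw [hsqrt, div_le_iff₀ (Real.exp_pos _), mul_assoc, ← Real.exp_add]
      rw [show -(Real.log (d n) / 4) + Real.log (d n) / 2 = Real.log (d n) / 4 by ring]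
      linarith
    linarith

theorem bicluster_isotropic_rate (hk : ∀ n, 1 ≤ k n) (hkd : ∀ n, k n < d n)
    (hd : Tendsto d atTop atTop) :
    IsMinimaxRate (fun n μ => minimaxRisk (isotropicLaw (bicluster (d n) (k n) μ)))
      (fun n => √(Real.log ((k n : ℝ) * ((d n : ℝ) - (k n : ℝ))) / (k n : ℝ))) := by
  have hdpos : ∀ n, (0 : ℝ) < d n := fun n => by
    exact_mod_cast (Nat.zero_le _).trans_lt (hkd n)
  have hratio : ∀ n, (d n : ℝ) ^ 2 * k n / (d n : ℝ) ^ 2 = k n := fun n =>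
    mul_div_cancel_left₀ _ (pow_pos (hdpos n) 2).ne'
  -- Unit precision at each of the d² entries spends exactly the budget τ = d².
  have h := isMinimaxRate_of_bounds hk hkd hd (τ := fun n => (d n : ℝ) ^ 2)
    (fun n => pow_pos (hdpos n) 2)
    (R := fun n μ => minimaxRisk (isotropicLaw (bicluster (d n) (k n) μ)))
    (fun n μ => by
      have := nonempty_kset (hkd n).le
      exact minimaxRisk_le_one _)
    (fun n μ hμ => by
      rw [isotropicLaw_eq_designLaw, hratio]
      simpa using minimaxRisk_designLaw_const_le (hkd n).le hμ one_ne_zero)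
    (fun n μ => by
      rw [isotropicLaw_eq_designLaw]
      refine minimaxRisk_designLaw_ge (hk n) (hkd n) μ (pow_pos (hdpos n) 2) _ ?_
      simp [sq])
  convert h using 3 with n
  have := (hdpos n).ne'
  have : (k n : ℝ) ≠ 0 := by exact_mod_cast (Nat.one_le_iff_ne_zero.1 (hk n))
  field_simp

theorem bicluster_design_rate (hk : ∀ n, 1 ≤ k n) (hkd : ∀ n, k n < d n)
    (hd : Tendsto d atTop atTop) {τ : ℕ → ℝ} (hτ : ∀ n, 0 < τ n) :
    IsMinimaxRate (fun n μ => designMinimaxRisk (bicluster (d n) (k n) μ) (τ n))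
      (fun n => √((d n : ℝ) ^ 2 / (τ n * (k n : ℝ)) *
        Real.log ((k n : ℝ) * ((d n : ℝ) - (k n : ℝ))))) := by
  have hdpos : ∀ n, (0 : ℝ) < d n := fun n => by
    exact_mod_cast (Nat.zero_le _).trans_lt (hkd n)
  refine isMinimaxRate_of_bounds hk hkd hd hτ (fun n μ => ?_) (fun n μ hμ => ?_) (fun n μ => ?_)
  · have := nonempty_kset (hkd n).le
    exact (iInf₂_le (fun _ => 0) (by simpa using (hτ n).le)).trans (minimaxRisk_le_one _)
  · have hb : 0 < τ n / (d n : ℝ) ^ 2 := div_pos (hτ n) (pow_pos (hdpos n) 2)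
    have hbudget : ∑ _p : Fin (d n) × Fin (d n), (((τ n / (d n : ℝ) ^ 2).toNNReal : ℝ≥0) : ℝ) ≤
        τ n := by
      rw [Real.coe_toNNReal _ hb.le]
      simp only [Finset.sum_const, Finset.card_univ, Fintype.card_prod, Fintype.card_fin,
        nsmul_eq_mul, Nat.cast_mul]
      rw [← sq, mul_div_cancel₀ _ (pow_pos (hdpos n) 2).ne']
    refine (iInf₂_le (fun _ => (τ n / (d n : ℝ) ^ 2).toNNReal) hbudget).trans
      ((minimaxRisk_designLaw_const_le (hkd n).le hμ (Real.toNNReal_pos.2 hb).ne').trans_eq ?_)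
    rw [Real.coe_toNNReal _ hb.le]
    congr 7
    ring
  · exact le_iInf₂ fun B hB => minimaxRisk_designLaw_ge (hk n) (hkd n) μ (hτ n) B hB

end Rates

end NormalMeans

open NormalMeans in
theorem corollary2 :
    -- minimax rates, along any sequence of problems with `1 ≤ k < d` and `d → ∞`
    (∀ d k : ℕ → ℕ, (∀ n, 1 ≤ k n) → (∀ n, k n < d n) → Tendsto d atTop atTop →
      IsMinimaxRate (fun n μ => minimaxRisk (isotropicLaw (bicluster (d n) (k n) μ)))
        (fun n => √(Real.log ((k n : ℝ) * ((d n : ℝ) - (k n : ℝ))) / (k n : ℝ))) ∧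
      ∀ τ : ℕ → ℝ, (∀ n, 0 < τ n) →
        IsMinimaxRate (fun n μ => designMinimaxRisk (bicluster (d n) (k n) μ) (τ n))
          (fun n => √((d n : ℝ) ^ 2 / (τ n * (k n : ℝ)) *
            Real.log ((k n : ℝ) * ((d n : ℝ) - (k n : ℝ)))))) ∧
    -- invariance of the family, and exact minimax optimality of the MLE, for each fixed problem
    (∀ (d k : ℕ) (μ : ℝ), k ≤ d → 0 < μ →
      (∀ v ∈ Set.range (bicluster d k μ),
        Set.range (fun (g : Equiv.Perm (Fin d) × Equiv.Perm (Fin d)) (p : Fin d × Fin d) =>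
          v (g.1 p.1, g.2 p.2)) = Set.range (bicluster d k μ)) ∧
      (∃ T, IsMLE (bicluster d k μ) T) ∧
      ∀ T, IsMLE (bicluster d k μ) T →
        maxRisk (isotropicLaw (bicluster d k μ)) T =
          minimaxRisk (isotropicLaw (bicluster d k μ))) := by
  refine ⟨fun d k hk hkd hd => ⟨bicluster_isotropic_rate hk hkd hd,
    fun τ hτ => bicluster_design_rate hk hkd hd hτ⟩, fun d k μ hkd hμ => ?_⟩
  have := nonempty_kset hkd
  exact ⟨range_bicluster_perm μ, exists_isMLE _, fun T hT => bicluster_isMLE_minimax hkd hμ.ne' hT⟩
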